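/- **Setting.** Let $P_1,\dots,P_{T+1}$ ($T\ge 1$) be probability distributions (domains) on $\mathcal X\times\mathcal Y$, $\mathcal Y$ finite, such that $P_{t+1}(Y=y)=0$ whenever $P_t(Y=y)=0$. For $t\le T$ let $P_t^W$ be the importance-weighted domain $dP^W_t(x,y)=w_y\,dP_t(x,y)$, $w_y=P_{t+1}(Y=y)/P_t(Y=y)$ (with $0/0=0$), and write $\mu_t$ and $\nu_t$ for the distributions of the input $X$ under $P_t^W$ and $P_{t+1}$. Let $\mathcal A\subset\mathbb R^p$, $\mathcal B\subset\mathbb R^q$, $\Gamma\subset\mathbb R^r$ be bounded parameter sets, $F_\alpha,G_\beta:\mathcal X\to\mathcal Z$ ($\alpha\in\mathcal A,\beta\in\mathcal B$) measurable representation networks and $D_\gamma:\mathcal Z\to[0,1]$ ($\gamma\in\Gamma$) measurable discriminators. Write $P^Z_{\alpha}=F_\alpha\sharp\mu_t$ and $P^Z_\beta=G_\beta\sharp\nu_t$ for the induced representation distributions (they depend on $t$). Assume: * (regularity) $D_\gamma(F_\alpha(x))>0$ and $D_\gamma(G_\beta(x))<1$ for all $\alpha,\beta,\gamma,x$, and for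 some $K\ge0$, uniformly in $x$, the map $(\alpha,\gamma)\mapsto\log D_\gamma(F_\alpha(x))$ on $\mathcal A\times\Gamma$ and the map $(\beta,\gamma)\mapsto\log(1-D_\gamma(G_\beta(x)))$ on $\mathcal B\times\Gamma$ are $K$-Lipschitz for the Euclidean norm; * (discriminator capacity) for all $t\le T$, $\alpha\in\mathcal A$, $\beta\in\mathcal B$ some $\gamma\in\Gamma$ satisfies $D_\gamma=\dfrac{dP^Z_\alpha}{d(P^Z_\alpha+P^Z_\beta)}$ almost everywhere with respect to $P^Z_\alpha+P^Z_\beta$. For each $t\le T$ let $x_t^1,\dots,x_t^n$ be i.i.d. from $\mu_t$ and $x_{t+1}^1,\dots,x_{t+1}^n$ i.i.d. from $\nu_t$ ($n\ge1$; no independence between different datasets is needed). Let $(\widehat\alpha_t,\widehat\beta_t)$ be random variables which almost surely attain $$\inf_{\alpha\in\mathcal A,\beta\in\mathcal B}\ \sup_{\gamma\in\Gamma}\Big(\frac1n\sum_{i=1}^n\log D_\gamma(F_\alpha(x_t^i))+\frac1n\sum_{i=1}^n\log\big(1-D_\gamma(G_\beta(x_{t+1}^i))\big)\Big),$$ and let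 $(\alpha_t^*,\beta_t^*)$ attain the infinite-data counterpart $$\inf_{\alpha\in\mathcal A,\beta\in\mathcal B}\ \sup_{\gamma\in\Gamma}\Big(\int\log D_\gamma\,dP^Z_\alpha+\int\log(1-D_\gamma)\,dP^Z_\beta\Big).$$ Put $D_{src}(\alpha,\beta)=\frac1T\sum_{t=1}^T\mathcal D_{JS}(P^Z_{\alpha_t}\,\|\,P^Z_{\beta_t})$, where $\mathcal D_{JS}$ is the Jensen–Shannon divergence (natural logarithm, $\mathcal D_{JS}(P\|Q)=\frac12\mathrm{KL}(P\|\frac{P+Q}2)+\frac12\mathrm{KL}(Q\|\frac{P+Q}2)$). **Proposition.** There is a function $C:\mathbb R\times\mathbb N\to\mathbb R$ such that in every such setting $D_{src}(\widehat\alpha,\widehat\beta)$ is integrable and $$\mathbb E\big[D_{src}(\widehat\alpha,\widehat\beta)\big]\ \le\ D_{src}(\alpha^*,\beta^*)+\frac{K\cdot C\big(\operatorname{diam}(\mathcal A\times\mathcal B\times\Gamma),\,p+q+r\big)}{\sqrt n},$$ the diameter being taken in the Euclidean norm of $\mathbb R^{p+q+r}$. Thus the constant depends only on the Lipschitz constant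 and on the diameter and dimension of the parameter spaces, not on $n$, $T$, the domains, the networks or the spaces. -/

import Mathlib

open MeasureTheory ProbabilityTheory
open scoped ENNReal

namespace AdvRep

noncomputable section

/-- The Jensen-Shannon divergence (natural logarithm) of two probability measures:
`(1/2) KL(P ‖ M) + (1/2) KL(Q ‖ M)` with `M = (P + Q) / 2`. Both terms are at most `log 2`, so
`toReal` loses nothing. -/
def jsDiv {Z : Type*} [MeasurableSpace Z] (P Q : Measure Z) : ℝ :=
  (1 / 2) * (InformationTheory.klDiv P ((2⁻¹ : ℝ≥0∞) • (P + Q))).toReal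
    + (1 / 2) * (InformationTheory.klDiv Q ((2⁻¹ : ℝ≥0∞) • (P + Q))).toReal

/-- The probability of the label `y` in the domain `P` (a law on inputs × labels). -/
def labelProb {X Y : Type*} [MeasurableSpace X] [MeasurableSpace Y]
    (P : Measure (X × Y)) (y : Y) : ℝ≥0∞ :=
  P {p | p.2 = y}

/-- The importance-weighted domain: `P` reweighted to the label distribution of `P'` by the factors
`w_y = P'(Y = y) / P(Y = y)`. -/
def reweighted {X Y : Type*} [MeasurableSpace X] [MeasurableSpace Y]
    (P P' : Measure (X × Y)) : Measure (X × Y) :=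
  P.withDensity fun p => labelProb P' p.2 / labelProb P p.2

/-- The parameter space `A × B × Γ` as a subset of a Euclidean space of dimension `p + q + r`
(`WithLp 2` carries the Euclidean norm `√(‖α‖² + ‖β‖² + ‖γ‖²)`). -/
def paramSpace {p q r : ℕ} (A : Set (EuclideanSpace ℝ (Fin p)))
    (B : Set (EuclideanSpace ℝ (Fin q))) (Γ : Set (EuclideanSpace ℝ (Fin r))) :
    Set (WithLp 2 (EuclideanSpace ℝ (Fin p) ×
      WithLp 2 (EuclideanSpace ℝ (Fin q) × EuclideanSpace ℝ (Fin r)))) :=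
  {θ | θ.fst ∈ A ∧ θ.snd.fst ∈ B ∧ θ.snd.snd ∈ Γ}

/-- The empirical adversarial objective
`(1/n) ∑ log D_γ(F_α(x_i)) + (1/n) ∑ log (1 - D_γ(G_β(x'_i)))`. -/
def empObjective {X Z a b c : Type*} (F : a → X → Z) (G : b → X → Z) (D : c → Z → ℝ)
    {n : ℕ} (x x' : Fin n → X) (α : a) (β : b) (γ : c) : ℝ :=
  (1 / (n : ℝ)) * ∑ i, Real.log (D γ (F α (x i)))
    + (1 / (n : ℝ)) * ∑ i, Real.log (1 - D γ (G β (x' i)))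

/-- The infinite-data adversarial objective
`∫ log D_γ(z) dP_α(z) + ∫ log (1 - D_γ(z)) dP_β(z)`, where `P_α` and `P_β` are the laws of the
representations `F_α(x)`, `x ∼ P`, and `G_β(x')`, `x' ∼ Q`. -/
def popObjective {X Z a b c : Type*} [MeasurableSpace X] [MeasurableSpace Z]
    (F : a → X → Z) (G : b → X → Z) (D : c → Z → ℝ) (P Q : Measure X)
    (α : a) (β : b) (γ : c) : ℝ :=
  (∫ z, Real.log (D γ z) ∂(P.map (F α))) + ∫ z, Real.log (1 - D γ z) ∂(Q.map (G β))

/-- `(α, β) ∈ A × B` attains `inf_{α, β} sup_{γ ∈ Γ} obj α β γ`. -/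
def IsMinimax {a b c : Type*} (obj : a → b → c → ℝ) (A : Set a) (B : Set b) (Γ : Set c)
    (α : a) (β : b) : Prop :=
  α ∈ A ∧ β ∈ B ∧ ∀ α' ∈ A, ∀ β' ∈ B, (⨆ γ : Γ, obj α β γ) ≤ ⨆ γ : Γ, obj α' β' γ

/-- The law of the inputs in the importance-weighted version of the `t`-th domain. -/
def sourceLaw {X Y : Type*} [MeasurableSpace X] [MeasurableSpace Y] {T : ℕ}
    (P : Fin (T + 1) → Measure (X × Y)) (t : Fin T) : Measure X :=
  (reweighted (P t.castSucc) (P t.succ)).map Prod.fst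

/-- The law of the inputs in the domain following the `t`-th one. -/
def nextLaw {X Y : Type*} [MeasurableSpace X] [MeasurableSpace Y] {T : ℕ}
    (P : Fin (T + 1) → Measure (X × Y)) (t : Fin T) : Measure X :=
  (P t.succ).map Prod.fst

/-- The average over `t` of the Jensen-Shannon divergence between the representation laws. -/
def dSrc {X Y Z a b : Type*} [MeasurableSpace X] [MeasurableSpace Y] [MeasurableSpace Z] {T : ℕ}
    (P : Fin (T + 1) → Measure (X × Y)) (F : a → X → Z) (G : b → X → Z)
    (α : Fin T → a) (β : Fin T → b) : ℝ :=
  (1 / (T : ℝ)) * ∑ t, jsDiv ((sourceLaw P t).map (F (α t))) ((nextLaw P t).map (G (β t)))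

end

end AdvRep

/-!
The Jensen-Shannon divergence of two representation laws is, up to an affine rescaling, the supremum
of the population objective over all discriminators, attained at the density of the first law with
respect to the sum of both (`jsDiv_eq`, `integral_log_discriminator_le_jsDiv`). By the capacity
hypothesis this density is available as a discriminator, so comparing divergences amounts to
comparing population objectives.

For an empirical minimax pair, the excess of its divergence over that of any other pair is bounded
by differences of the centred empirical processes of `log D_γ(F_α)` and `log (1 - D_γ(G_β))` at two
parameters (`IsAdversarialPair.jsDiv_le_of_isMinimax`). That only differences occur is essential:
the log-terms themselves may be unbounded, whereas their differences are bounded through the Lipschitz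
constant. No independence between the two samples is needed, as the two processes are treated
separately.

The oscillation of such a process over its bounded parameter set is controlled by chaining
(`exists_uniform_empDev_bound`). For `d` parameters ranging over intervals of length `R`, a grid of
mesh `R / 2 ^ k` supplies a net of at most `2 ^ ((k + 2) d)` points (`exists_grid_net`). By Hoeffding's lemma a link between consecutive nets has sub-Gaussian
deviation of size `σ_k`, of order `K R / (2 ^ k √n)`, and a soft maximum over the net costs a factor
linear in `k d` (`exists_finset_empDev_bound`). The square root of the logarithm, available with the
optimal scale, is not needed since `∑ k / 2 ^ k` converges anyway. All bounds are by explicit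
integrable random variables, so that no supremum over an uncountable class has to be measured.

Finally, the divergence is a Lipschitz function of the representation parameters, being a supremum
of uniformly Lipschitz functions; this makes its value at the learned parameters measurable
(`IsAdversarialPair.integrable_jsDiv_comp`).
-/

namespace AdvRep

/-! ### The Jensen-Shannon divergence and optimal discriminators -/

section JensenShannon

variable {Z : Type*} [MeasurableSpace Z]

lemma ae_rnDeriv_add_mem_Icc (P Q : Measure Z) [IsFiniteMeasure P] [IsFiniteMeasure Q] :
    ∀ᵐ z ∂(P + Q), (P.rnDeriv (P + Q) z).toReal ∈ Set.Icc (0 : ℝ) 1 := by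
  filter_upwards [Measure.rnDeriv_le_one_of_le (Measure.le_add_right (le_refl P) : P ≤ P + Q)]
    with z hz
  exact ⟨ENNReal.toReal_nonneg, ENNReal.toReal_le_of_le_ofReal zero_le_one (by simpa using hz)⟩

lemma ae_rnDeriv_add_right_eq (P Q : Measure Z) [IsFiniteMeasure P] [IsFiniteMeasure Q] :
    ∀ᵐ z ∂(P + Q),
      (Q.rnDeriv (P + Q) z).toReal = 1 - (P.rnDeriv (P + Q) z).toReal := by
  filter_upwards [Measure.rnDeriv_add P Q (P + Q), Measure.rnDeriv_self (P + Q),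
    Measure.rnDeriv_lt_top P (P + Q), Measure.rnDeriv_lt_top Q (P + Q)] with z h1 h2 h3 h4
  rw [h2, Pi.add_apply] at h1
  have := congrArg ENNReal.toReal h1
  rw [ENNReal.toReal_add h3.ne h4.ne, ENNReal.toReal_one] at this
  linarith

lemma integrable_log_rnDeriv_add (P Q : Measure Z) [IsFiniteMeasure P] [IsFiniteMeasure Q] :
    Integrable (fun z => Real.log (P.rnDeriv (P + Q) z).toReal) P := by
  have hac : P ≪ P + Q := Measure.absolutelyContinuous_of_le (Measure.le_add_right le_rfl)
  rw [← integrable_rnDeriv_smul_iff hac]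
  refine Integrable.of_bound (C := 1) ?_ ?_
  · exact ((Measure.measurable_rnDeriv _ _).ennreal_toReal.mul
      (Measure.measurable_rnDeriv _ _).ennreal_toReal.log).aestronglyMeasurable
  · filter_upwards [ae_rnDeriv_add_mem_Icc P Q] with z hz
    rw [smul_eq_mul, mul_comm, Real.norm_eq_abs]
    rcases hz.1.eq_or_lt with h | h
    · simp [← h]
    · exact (Real.abs_log_mul_self_lt _ h hz.2).le

/-- The entropy of `P` relative to the midpoint of `P` and `Q`, in terms of the density of `P` with
respect to `P + Q`. -/
lemma toReal_klDiv_midpoint (P Q : Measure Z) [IsProbabilityMeasure P] [IsProbabilityMeasure Q] :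
    (InformationTheory.klDiv P ((2⁻¹ : ℝ≥0∞) • (P + Q))).toReal
      = Real.log 2 + ∫ z, Real.log (P.rnDeriv (P + Q) z).toReal ∂P := by
  have hac : P ≪ P + Q := Measure.absolutelyContinuous_of_le (Measure.le_add_right le_rfl)
  have h2 : (2⁻¹ : ℝ≥0∞) ≠ 0 := by simp
  have h2' : (2⁻¹ : ℝ≥0∞) ≠ ∞ := by simp
  have : IsFiniteMeasure ((2⁻¹ : ℝ≥0∞) • (P + Q)) := Measure.smul_finite _ h2'
  have hac' : P ≪ (2⁻¹ : ℝ≥0∞) • (P + Q) :=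
    hac.trans (Measure.absolutelyContinuous_smul h2)
  rw [InformationTheory.toReal_klDiv_of_measure_eq hac']
  · rw [integral_congr_ae (llr_smul_right hac _ h2 h2')]
    simp only [llr_def]
    rw [integral_sub (integrable_log_rnDeriv_add P Q) (integrable_const _)]
    simp [ENNReal.toReal_inv, Real.log_inv, add_comm]
  · simp only [measure_univ, Measure.smul_apply, Measure.add_apply, smul_eq_mul]
    rw [one_add_one_eq_two, ENNReal.inv_mul_cancel] <;> simp

lemma integrable_log_one_sub_rnDeriv_add (P Q : Measure Z) [IsFiniteMeasure P]
    [IsFiniteMeasure Q] :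
    Integrable (fun z => Real.log (1 - (P.rnDeriv (P + Q) z).toReal)) Q := by
  have h := integrable_log_rnDeriv_add Q P
  rw [add_comm Q P] at h
  have hac : Q ≪ P + Q := Measure.absolutelyContinuous_of_le (Measure.le_add_left le_rfl)
  refine h.congr ?_
  filter_upwards [hac.ae_le (ae_rnDeriv_add_right_eq P Q)] with z hz
  rw [hz]

/-- The Jensen-Shannon divergence is, up to an affine rescaling, the value of the adversarial
objective at the optimal discriminator `dP / d(P + Q)`. -/
lemma jsDiv_eq (P Q : Measure Z) [IsProbabilityMeasure P] [IsProbabilityMeasure Q] :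
    jsDiv P Q = Real.log 2 + (1 / 2) * ((∫ z, Real.log (P.rnDeriv (P + Q) z).toReal ∂P)
      + ∫ z, Real.log (1 - (P.rnDeriv (P + Q) z).toReal) ∂Q) := by
  have hac : Q ≪ P + Q := Measure.absolutelyContinuous_of_le (Measure.le_add_left le_rfl)
  have h := toReal_klDiv_midpoint Q P
  rw [add_comm Q P] at h
  have h' : ∫ z, Real.log (Q.rnDeriv (P + Q) z).toReal ∂Q
      = ∫ z, Real.log (1 - (P.rnDeriv (P + Q) z).toReal) ∂Q := by
    refine integral_congr_ae ?_
    filter_upwards [hac.ae_le (ae_rnDeriv_add_right_eq P Q)] with z hz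
    rw [hz]
  rw [jsDiv, h, h', toReal_klDiv_midpoint]
  ring

lemma jsDiv_nonneg (P Q : Measure Z) : 0 ≤ jsDiv P Q := by
  unfold jsDiv; positivity

lemma mul_log_sub_log_le {g d : ℝ} (hg : 0 ≤ g) (hd : 0 ≤ d) (h : g ≠ 0 → 0 < d) :
    g * (Real.log d - Real.log g) ≤ d - g := by
  rcases hg.eq_or_lt with rfl | hg'
  · simpa using hd
  · have hd' := h hg'.ne'
    have := Real.log_le_sub_one_of_pos (div_pos hd' hg')
    rw [Real.log_div hd'.ne' hg'.ne'] at this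
    calc g * (Real.log d - Real.log g) ≤ g * (d / g - 1) := by gcongr
      _ = d - g := by field_simp

/-- Gibbs' inequality for discriminators: no discriminator beats `dP / d(P + Q)`. -/
lemma integral_log_discriminator_le_jsDiv (P Q : Measure Z) [IsProbabilityMeasure P]
    [IsProbabilityMeasure Q] {D : Z → ℝ} (hD : ∀ z, D z ∈ Set.Icc (0 : ℝ) 1)
    (h0 : ∀ᵐ z ∂P, 0 < D z) (h1 : ∀ᵐ z ∂Q, D z < 1)
    (hi0 : Integrable (fun z => Real.log (D z)) P)
    (hi1 : Integrable (fun z => Real.log (1 - D z)) Q) :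
    (∫ z, Real.log (D z) ∂P) + ∫ z, Real.log (1 - D z) ∂Q ≤ 2 * (jsDiv P Q - Real.log 2) := by
  have hP : P ≪ P + Q := Measure.absolutelyContinuous_of_le (Measure.le_add_right le_rfl)
  have hQ : Q ≪ P + Q := Measure.absolutelyContinuous_of_le (Measure.le_add_left le_rfl)
  rw [jsDiv_eq]
  set g : Z → ℝ := fun z => (P.rnDeriv (P + Q) z).toReal with hg
  have hg0 : Integrable (fun z => Real.log (g z)) P := integrable_log_rnDeriv_add P Q
  have hg1 : Integrable (fun z => Real.log (1 - g z)) Q := integrable_log_one_sub_rnDeriv_add P Q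
  suffices h : (∫ z, (Real.log (D z) - Real.log (g z)) ∂P)
      + ∫ z, (Real.log (1 - D z) - Real.log (1 - g z)) ∂Q ≤ 0 by
    rw [integral_sub hi0 hg0, integral_sub hi1 hg1] at h
    linarith
  have hI0 := (integrable_rnDeriv_smul_iff hP).2 (hi0.sub hg0)
  have hI1 := (integrable_rnDeriv_smul_iff hQ).2 (hi1.sub hg1)
  rw [← integral_rnDeriv_smul hP, ← integral_rnDeriv_smul hQ]
  refine (integral_add hI0 hI1).symm.trans_le ?_
  refine integral_nonpos_of_ae ?_
  filter_upwards [ae_rnDeriv_add_mem_Icc P Q, ae_rnDeriv_add_right_eq P Q,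
    Measure.ae_rnDeriv_ne_zero_imp_of_ae (ν := P + Q) h0,
    Measure.ae_rnDeriv_ne_zero_imp_of_ae (ν := P + Q) h1,
    Measure.rnDeriv_lt_top P (P + Q), Measure.rnDeriv_lt_top Q (P + Q)] with z a1 a2 a3 a4 a5 a6
  have b1 := mul_log_sub_log_le (g := g z) a1.1 (hD z).1 fun h => a3 fun h' => h (by simp [hg, h'])
  have b2 := mul_log_sub_log_le (g := 1 - g z) (d := 1 - D z) (sub_nonneg.2 a1.2)
    (sub_nonneg.2 (hD z).2) fun h => sub_pos.2 (a4 fun h' => h (by rw [← a2, h']; simp))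
  simp only [smul_eq_mul, Pi.sub_apply, Pi.zero_apply, a2]
  change g z * _ + (1 - g z) * _ ≤ 0
  linarith

end JensenShannon

/-! ### Grid nets and chaining -/

section Chaining

/-- A set whose coordinates vary by at most `R` has, at every scale `R / 2 ^ k`, a finite net of
size exponential in `k` times the number of coordinates: a representative in the set for each cell
of a grid. -/
lemma exists_grid_net {Θ ι : Type*} [Fintype ι] (c : Θ → ι → ℝ) {S : Set Θ} (hS : S.Nonempty)
    {R : ℝ} (hR : 0 < R) (h : ∀ θ ∈ S, ∀ θ' ∈ S, ∀ i, |c θ i - c θ' i| ≤ R) (k : ℕ) :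
    ∃ N : Finset Θ, ↑N ⊆ S ∧ N.card ≤ 2 ^ ((k + 2) * Fintype.card ι) ∧
      ∀ θ ∈ S, ∃ s ∈ N, ∀ i, |c θ i - c s i| ≤ R / 2 ^ k := by
  classical
  obtain ⟨θ₀, hθ₀⟩ := hS
  have h2 : (0 : ℝ) < 2 ^ k := by positivity
  let cell : Θ → ι → ℤ := fun θ i => ⌊(c θ i - c θ₀ i) / (R / 2 ^ k)⌋
  have hrep : ∀ v, ∃ s, s ∈ S ∧ ((∃ θ ∈ S, cell θ = v) → cell s = v) := fun v => by
    by_cases hv : ∃ θ ∈ S, cell θ = v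
    · obtain ⟨θ, hθ, hθv⟩ := hv
      exact ⟨θ, hθ, fun _ => hθv⟩
    · exact ⟨θ₀, hθ₀, fun h => absurd h hv⟩
  choose rep hrepS hrep using hrep
  let cells : Finset (ι → ℤ) := Fintype.piFinset fun _ => Finset.Icc (-2 ^ k : ℤ) (2 ^ k)
  refine ⟨cells.image rep, ?_, ?_, fun θ hθ => ⟨rep (cell θ), ?_, fun i => ?_⟩⟩
  · intro s hs
    obtain ⟨v, -, rfl⟩ := Finset.mem_image.1 (Finset.mem_coe.1 hs)
    exact hrepS v
  · refine Finset.card_image_le.trans ?_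
    rw [Fintype.card_piFinset, pow_mul]
    simp only [Int.card_Icc, Finset.prod_const, Finset.card_univ]
    refine Nat.pow_le_pow_left ?_ _
    have : (1 : ℤ) ≤ 2 ^ k := one_le_pow₀ (by norm_num)
    zify
    rw [Int.toNat_of_nonneg (by linarith), pow_add]
    linarith
  · refine Finset.mem_image_of_mem _ (Fintype.mem_piFinset.2 fun i => Finset.mem_Icc.2 ?_)
    have hb := abs_le.1 (h θ hθ θ₀ hθ₀ i)
    constructor
    · refine Int.le_floor.2 ?_
      rw [le_div_iff₀ (by positivity)]
      push_cast
      rw [neg_mul, mul_div_cancel₀ _ h2.ne']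
      exact hb.1
    · refine Int.floor_le_iff.2 ?_
      rw [div_lt_iff₀ (by positivity)]
      push_cast
      rw [add_mul, mul_div_cancel₀ _ h2.ne']
      have : 0 < R / 2 ^ k := by positivity
      linarith [hb.2]
  · have hc := congrFun (hrep (cell θ) ⟨θ, hθ, rfl⟩) i
    have := (Int.abs_sub_lt_one_of_floor_eq_floor hc).le
    rw [← sub_div, abs_div, abs_of_pos (show 0 < R / 2 ^ k by positivity),
      div_le_one (by positivity)] at this
    rw [abs_sub_comm]
    simpa using this

/-- The chaining inequality: along successive approximations `π k`, the oscillation of `Δ` is at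
most the sum over the levels of the oscillations `M k` along single links. -/
lemma abs_sub_le_sum_of_chain {Θ : Type*} (Δ : Θ → ℝ) {N : ℕ → Finset Θ} {π : ℕ → Θ → Θ}
    {M : ℕ → ℝ} {θ₀ : Θ} (h0 : ∀ s ∈ N 0, s = θ₀) (hπ : ∀ k, ∀ s ∈ N (k + 1), π k s ∈ N k)
    (hM : ∀ k, ∀ s ∈ N (k + 1), |Δ s - Δ (π k s)| ≤ M k) (m : ℕ) :
    ∀ s ∈ N m, |Δ s - Δ θ₀| ≤ ∑ k ∈ Finset.range m, M k := by
  induction m with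
  | zero => intro s hs; simp [h0 s hs]
  | succ m ih =>
    intro s hs
    rw [Finset.sum_range_succ]
    linarith [abs_sub_le (Δ s) (Δ (π m s)) (Δ θ₀), hM m s hs, ih _ (hπ m s hs)]

lemma le_log_add_exp_div {a : ℝ} (ha : 0 < a) (t : ℝ) : t ≤ Real.log a + Real.exp t / a := by
  have := Real.log_le_sub_one_of_pos (div_pos (Real.exp_pos t) ha)
  rw [Real.log_div (Real.exp_pos t).ne' ha.ne', Real.log_exp] at this
  linarith

lemma sum_add_four_div_two_pow_le (m : ℕ) :
    ∑ k ∈ Finset.range m, ((k : ℝ) + 4) / 2 ^ k ≤ 10 := by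
  have h : ∑ k ∈ Finset.range m, ((k : ℝ) + 4) / 2 ^ k = 10 - (m + 5) * 2 / 2 ^ m := by
    induction m with
    | zero => norm_num
    | succ m ih =>
      rw [Finset.sum_range_succ, ih]
      push_cast
      field_simp
      ring
  rw [h]
  have : (0 : ℝ) ≤ (m + 5) * 2 / 2 ^ m := by positivity
  linarith

end Chaining

/-! ### Deviations of empirical means -/

section Deviation

variable {X Ω : Type*} [MeasurableSpace X] [MeasurableSpace Ω]

/-- The deviation of the empirical mean of `g` over the sample `x₁, …, xₙ` from its mean under
`ν`. -/
noncomputable def empDev (ν : Measure X) {n : ℕ} (x : Fin n → X) (g : X → ℝ) : ℝ :=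
  (1 / (n : ℝ)) * ∑ i, g (x i) - ∫ y, g y ∂ν

lemma empDev_sub (ν : Measure X) {n : ℕ} (x : Fin n → X) {g h : X → ℝ} (hg : Integrable g ν)
    (hh : Integrable h ν) : empDev ν x g - empDev ν x h = empDev ν x (g - h) := by
  simp only [empDev, Pi.sub_apply, Finset.sum_sub_distrib]
  rw [integral_sub hg hh]
  ring

lemma abs_empDev_le (ν : Measure X) [IsProbabilityMeasure ν] {n : ℕ} (x : Fin n → X) {g : X → ℝ}
    {b : ℝ} (hb : 0 ≤ b) (hg : ∀ y, |g y| ≤ b) : |empDev ν x g| ≤ 2 * b := by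
  have h1 : |∫ y, g y ∂ν| ≤ b := by
    simpa using norm_integral_le_of_norm_le_const (μ := ν) (f := g) (ae_of_all _ hg)
  have h2 : |(1 / (n : ℝ)) * ∑ i, g (x i)| ≤ b := by
    rw [abs_mul, abs_of_nonneg (by positivity)]
    have : |∑ i, g (x i)| ≤ n * b := by
      refine (Finset.abs_sum_le_sum_abs _ _).trans ?_
      simpa using Finset.sum_le_sum fun (i : Fin n) (_ : i ∈ Finset.univ) => hg (x i)
    rcases n.eq_zero_or_pos with rfl | hn
    · simpa using hb
    · have : (0 : ℝ) < n := by exact_mod_cast hn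
      rw [one_div, inv_mul_le_iff₀ this]
      assumption
  unfold empDev
  linarith [abs_sub ((1 / (n : ℝ)) * ∑ i, g (x i)) (∫ y, g y ∂ν)]

/-- Hoeffding's lemma for the empirical mean of a bounded function of an i.i.d. sample. -/
lemma exp_empDev_integrable_and_le {μ : Measure Ω} [IsProbabilityMeasure μ] {ν : Measure X}
    {n : ℕ} (hn : 0 < n) {x : Fin n → Ω → X} (hx : ∀ i, Measurable (x i)) (hind : iIndepFun x μ)
    (hlaw : ∀ i, μ.map (x i) = ν) {g : X → ℝ} (hg : Measurable g) {b : ℝ}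
    (hgb : ∀ y, |g y| ≤ b) (t : ℝ) :
    Integrable (fun ω => Real.exp (t * empDev ν (fun i => x i ω) g)) μ ∧
      ∫ ω, Real.exp (t * empDev ν (fun i => x i ω) g) ∂μ
        ≤ Real.exp (b ^ 2 * t ^ 2 / (2 * n)) := by
  have hn' : (0 : ℝ) < n := by exact_mod_cast hn
  have hmean : ∀ i, ∫ ω, g (x i ω) ∂μ = ∫ y, g y ∂ν := fun i => by
    rw [← hlaw i, integral_map (hx i).aemeasurable hg.aestronglyMeasurable]
  have hsub : ∀ i ∈ (Finset.univ : Finset (Fin n)), HasSubgaussianMGF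
      (fun ω => g (x i ω) - ∫ y, g y ∂ν) ((‖b - -b‖₊ / 2) ^ 2) μ := fun i _ => by
    rw [← hmean i]
    exact hasSubgaussianMGF_of_mem_Icc (hg.comp (hx i)).aemeasurable
      (ae_of_all _ fun ω => abs_le.1 (hgb _))
  have hsum := HasSubgaussianMGF.sum_of_iIndepFun
    (hind.comp (fun _ y => g y - ∫ y, g y ∂ν) fun _ => hg.sub_const _) hsub
  have heq : ∀ ω, t * empDev ν (fun i => x i ω) g
      = t / n * ∑ i, (g (x i ω) - ∫ y, g y ∂ν) := fun ω => by
    simp only [empDev, Finset.sum_sub_distrib, Finset.sum_const, Finset.card_univ,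
      Fintype.card_fin, nsmul_eq_mul]
    field_simp
  simp only [heq]
  refine ⟨hsum.integrable_exp_mul (t / n), (hsum.mgf_le (t / n)).trans (Real.exp_le_exp.2 ?_)⟩
  simp only [Finset.sum_const, Finset.card_univ, Fintype.card_fin, nsmul_eq_mul]
  push_cast
  rw [Real.norm_eq_abs, div_pow, sq_abs]
  refine le_of_eq ?_
  field_simp
  ring

/-- A finite family of centred empirical means of functions bounded by `b` has a common bound whose
mean is of the order of `b / √n` times the logarithm of the size `a` of the family: a soft maximum,
at the scale `b / √n`. -/
lemma exists_finset_empDev_bound {Θ : Type*} {μ : Measure Ω} [IsProbabilityMeasure μ]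
    {ν : Measure X} {n : ℕ} (hn : 0 < n) {x : Fin n → Ω → X} (hx : ∀ i, Measurable (x i))
    (hind : iIndepFun x μ) (hlaw : ∀ i, μ.map (x i) = ν) (N : Finset Θ) (g : Θ → X → ℝ)
    (hg : ∀ s ∈ N, Measurable (g s)) {b : ℝ} (hb : 0 < b) (hgb : ∀ s ∈ N, ∀ y, |g s y| ≤ b)
    {a : ℝ} (ha : 1 ≤ a) (hN : (N.card : ℝ) ≤ a) :
    ∃ M : Ω → ℝ, Integrable M μ ∧ (∀ ω, ∀ s ∈ N, |empDev ν (fun i => x i ω) (g s)| ≤ M ω) ∧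
      ∫ ω, M ω ∂μ ≤ b / √n * (Real.log a + 4) := by
  have hn' : (0 : ℝ) < n := by exact_mod_cast hn
  have ha0 : 0 < a := by linarith
  set σ : ℝ := b / √n with hσ
  have hσ0 : 0 < σ := by positivity
  let E : Θ → ℝ → Ω → ℝ := fun s t ω => Real.exp (t * empDev ν (fun i => x i ω) (g s))
  have hE : ∀ s ∈ N, ∀ t, t ^ 2 = (1 / σ) ^ 2 → Integrable (E s t) μ ∧ ∫ ω, E s t ω ∂μ ≤ 2 := by
    intro s hs t ht
    obtain ⟨h1, h2⟩ := exp_empDev_integrable_and_le hn hx hind hlaw (hg s hs) (hgb s hs) t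
    refine ⟨h1, h2.trans ?_⟩
    have : b ^ 2 * t ^ 2 / (2 * n) = 1 / 2 := by
      rw [ht, hσ, one_div_div, div_pow, Real.sq_sqrt hn'.le]
      field_simp
    rw [this]
    -- `√e ≤ 2` because `e ≤ 4`
    have h3 : Real.exp (1 / 2) ^ 2 ≤ 2 ^ 2 := by
      rw [← Real.exp_nat_mul]
      norm_num
      linarith [Real.exp_one_lt_d9]
    exact (pow_le_pow_iff_left₀ (Real.exp_pos _).le (by norm_num) (by norm_num)).1 h3
  have hp := fun s hs => hE s hs (1 / σ) rfl
  have hm := fun s hs => hE s hs (-(1 / σ)) (neg_sq _)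
  let M : Ω → ℝ := fun ω => σ * (Real.log a + (∑ s ∈ N, (E s (1 / σ) ω + E s (-(1 / σ)) ω)) / a)
  have hadd : ∀ s ∈ N, Integrable (fun ω => E s (1 / σ) ω + E s (-(1 / σ)) ω) μ :=
    fun s hs => (hp s hs).1.add (hm s hs).1
  have hsum : Integrable (fun ω => ∑ s ∈ N, (E s (1 / σ) ω + E s (-(1 / σ)) ω)) μ :=
    integrable_finsetSum _ hadd
  refine ⟨M, ((integrable_const _).add (hsum.div_const a)).const_mul σ, fun ω s hs => ?_, ?_⟩
  · have key : ∀ t : ℝ, Real.exp (t / σ) ≤ E s (1 / σ) ω + E s (-(1 / σ)) ω → t ≤ M ω := by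
      intro t ht
      have h1 : E s (1 / σ) ω + E s (-(1 / σ)) ω
          ≤ ∑ s ∈ N, (E s (1 / σ) ω + E s (-(1 / σ)) ω) :=
        Finset.single_le_sum (f := fun s => E s (1 / σ) ω + E s (-(1 / σ)) ω)
          (fun s _ => add_nonneg (Real.exp_pos _).le (Real.exp_pos _).le) hs
      have h2 : t / σ ≤ Real.log a + (∑ s ∈ N, (E s (1 / σ) ω + E s (-(1 / σ)) ω)) / a := by
        refine (le_log_add_exp_div ha0 (t / σ)).trans ?_
        gcongr
        exact ht.trans h1
      rwa [div_le_iff₀' hσ0] at h2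
    refine abs_le'.2 ⟨key _ ?_, key _ ?_⟩
    · refine le_add_of_le_of_nonneg (le_of_eq ?_) (Real.exp_pos _).le
      simp only [E]
      congr 1
      ring
    · refine le_add_of_nonneg_of_le (Real.exp_pos _).le (le_of_eq ?_)
      simp only [E]
      congr 1
      ring
  · have hint : ∫ ω, ∑ s ∈ N, (E s (1 / σ) ω + E s (-(1 / σ)) ω) ∂μ ≤ a * 4 := by
      rw [integral_finsetSum _ hadd]
      calc ∑ s ∈ N, ∫ ω, (E s (1 / σ) ω + E s (-(1 / σ)) ω) ∂μ ≤ ∑ s ∈ N, (4 : ℝ) := by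
            refine Finset.sum_le_sum fun s hs => ?_
            rw [integral_add (hp s hs).1 (hm s hs).1]
            linarith [(hp s hs).2, (hm s hs).2]
        _ ≤ a * 4 := by
            rw [Finset.sum_const, nsmul_eq_mul]
            gcongr
    have hM : ∫ ω, M ω ∂μ
        = σ * (Real.log a + (∫ ω, ∑ s ∈ N, (E s (1 / σ) ω + E s (-(1 / σ)) ω) ∂μ) / a) := by
      rw [integral_const_mul, integral_add (integrable_const _) (hsum.div_const a),
        integral_div]
      simp
    rw [hM]
    gcongr
    rw [div_le_iff₀ ha0]
    linarith

/-- Uniform deviation bound for a class of functions which is `K`-Lipschitz in bounded parameters: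
the oscillation over the class of the centred empirical mean has a bound of mean `O(K / √n)`, with a
constant depending only on the number and the range of the parameters. Only oscillations are
controlled, since a single centred mean need not be small in terms of `K`. -/
theorem exists_uniform_empDev_bound {Θ ι : Type*} [Fintype ι] {μ : Measure Ω}
    [IsProbabilityMeasure μ] {ν : Measure X} {n : ℕ} (hn : 0 < n) {x : Fin n → Ω → X}
    (hx : ∀ i, Measurable (x i)) (hind : iIndepFun x μ) (hlaw : ∀ i, μ.map (x i) = ν)
    (c : Θ → ι → ℝ) {S : Set Θ} {R : ℝ} (hR : 0 < R)
    (hSR : ∀ θ ∈ S, ∀ θ' ∈ S, ∀ i, |c θ i - c θ' i| ≤ R) {f : Θ → X → ℝ}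
    (hf : ∀ θ ∈ S, Measurable (f θ)) (hfi : ∀ θ ∈ S, Integrable (f θ) ν) {K : ℝ} (hK : 0 ≤ K)
    (hLip : ∀ θ ∈ S, ∀ θ' ∈ S, ∀ y, |f θ y - f θ' y| ≤ K * ∑ i, |c θ i - c θ' i|)
    {θ₀ : Θ} (hθ₀ : θ₀ ∈ S) {η : ℝ} (hη : 0 < η) :
    ∃ M : Ω → ℝ, Integrable M μ ∧
      (∀ ω, ∀ θ ∈ S, |empDev ν (fun i => x i ω) (f θ) - empDev ν (fun i => x i ω) (f θ₀)| ≤ M ω) ∧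
      ∫ ω, M ω ∂μ ≤ K * (10 * ((Fintype.card ι : ℝ) + 1) ^ 2 * R) / √n + η := by
  have : IsProbabilityMeasure ν := by
    rw [← hlaw ⟨0, hn⟩]; exact Measure.isProbabilityMeasure_map (hx _).aemeasurable
  have hn' : (0 : ℝ) < n := by exact_mod_cast hn
  set d : ℕ := Fintype.card ι with hd
  have hdev : ∀ ω, ∀ θ ∈ S, ∀ θ' ∈ S, empDev ν (fun i => x i ω) (f θ)
      - empDev ν (fun i => x i ω) (f θ') = empDev ν (fun i => x i ω) (f θ - f θ') :=
    fun ω θ hθ θ' hθ' => empDev_sub ν _ (hfi θ hθ) (hfi θ' hθ')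
  rcases hK.eq_or_lt with rfl | hK
  · refine ⟨fun _ => 0, integrable_zero _ _ _, fun ω θ hθ => ?_, by simpa using hη.le⟩
    rw [hdev ω θ hθ θ₀ hθ₀]
    simpa using abs_empDev_le ν (fun i => x i ω) le_rfl (g := f θ - f θ₀)
      fun y => by simpa using hLip θ hθ θ₀ hθ₀ y
  -- bounds the uniform distance between functions whose coordinates differ by at most `R / 2 ^ k`;
  -- the `+ 1` keeps it positive when there are no coordinates
  let b : ℕ → ℝ := fun k => K * (((d : ℝ) + 1) * (R / 2 ^ k))
  have hb : ∀ k, 0 < b k := fun k => by positivity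
  have hclose : ∀ k, ∀ θ ∈ S, ∀ θ' ∈ S, (∀ i, |c θ i - c θ' i| ≤ R / 2 ^ k) →
      ∀ y, |(f θ - f θ') y| ≤ b k := by
    intro k θ hθ θ' hθ' h y
    refine (hLip θ hθ θ' hθ' y).trans ?_
    refine mul_le_mul_of_nonneg_left ?_ hK.le
    have h1 : ∑ i, |c θ i - c θ' i| ≤ d * (R / 2 ^ k) := by
      simpa [hd] using Finset.sum_le_sum fun i (_ : i ∈ Finset.univ) => h i
    have h2 : 0 ≤ R / 2 ^ k := by positivity
    linarith
  have hnet : ∀ k : ℕ, ∃ N : Finset Θ, ↑N ⊆ S ∧ N.card ≤ 2 ^ ((k + 2) * d) ∧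
      (∀ θ ∈ S, ∃ s ∈ N, ∀ i, |c θ i - c s i| ≤ R / 2 ^ k) ∧ (k = 0 → ∀ s ∈ N, s = θ₀) := by
    intro k
    rcases eq_or_ne k 0 with rfl | hk
    · refine ⟨{θ₀}, by simpa using hθ₀, by simpa using Nat.one_le_two_pow, fun θ hθ =>
        ⟨θ₀, by simp, fun i => by simpa using hSR θ hθ θ₀ hθ₀ i⟩, by simp⟩
    · obtain ⟨N, h1, h2, h3⟩ := exists_grid_net c ⟨θ₀, hθ₀⟩ hR hSR k
      exact ⟨N, h1, h2, h3, fun h => absurd h hk⟩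
  choose N hNS hNcard hNnet hN0 using hnet
  choose! π hπN hπ using hNnet
  have hlink : ∀ k : ℕ, ∃ M : Ω → ℝ, Integrable M μ ∧
      (∀ ω, ∀ s ∈ N (k + 1), |empDev ν (fun i => x i ω) (f s - f (π k s))| ≤ M ω) ∧
      ∫ ω, M ω ∂μ ≤ b k / √n * (Real.log (2 ^ ((k + 3) * d)) + 4) := by
    intro k
    refine exists_finset_empDev_bound hn hx hind hlaw (N (k + 1)) (fun s => f s - f (π k s))
      (fun s hs => ?_) (hb k) (fun s hs => ?_) (one_le_pow₀ (by norm_num)) ?_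
    · have hs' := hNS _ hs
      exact (hf s hs').sub (hf _ (hNS _ (hπN k s hs')))
    · have hs' := hNS _ hs
      exact hclose k s hs' _ (hNS _ (hπN k s hs')) (hπ k s hs')
    · exact_mod_cast hNcard (k + 1)
  choose M hMint hM hMle using hlink
  obtain ⟨m, hm⟩ : ∃ m : ℕ, 2 * b m ≤ η := by
    obtain ⟨m, hm⟩ := exists_pow_lt_of_lt_one
      (show 0 < η / (2 * (K * (((d : ℝ) + 1) * R))) by positivity)
      (show (1 / 2 : ℝ) < 1 by norm_num)
    refine ⟨m, ?_⟩
    rw [lt_div_iff₀ (by positivity), one_div, inv_pow] at hm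
    refine le_trans (le_of_eq ?_) hm.le
    simp only [b]
    field_simp
  refine ⟨fun ω => η + ∑ k ∈ Finset.range m, M k ω,
    (integrable_const _).add (integrable_finsetSum _ fun k _ => hMint k), fun ω θ hθ => ?_, ?_⟩
  · have hs := hπN m θ hθ
    have h1 : |empDev ν (fun i => x i ω) (f θ) - empDev ν (fun i => x i ω) (f (π m θ))| ≤ η := by
      rw [hdev ω θ hθ _ (hNS _ hs)]
      exact (abs_empDev_le ν _ (hb m).le (hclose m θ hθ _ (hNS _ hs) (hπ m θ hθ))).trans hm
    have h2 := abs_sub_le_sum_of_chain (fun θ => empDev ν (fun i => x i ω) (f θ))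
      (M := fun k => M k ω)
      (hN0 0 rfl) (fun k s hs => hπN k s (hNS _ hs))
      (fun k s hs => by
        rw [hdev ω s (hNS _ hs) _ (hNS _ (hπN k s (hNS _ hs)))]
        exact hM k ω s hs) m (π m θ) hs
    exact (abs_sub_le _ _ _).trans (add_le_add h1 h2)
  · rw [integral_add (integrable_const _) (integrable_finsetSum _ fun k _ => hMint k),
      integral_finsetSum _ fun k _ => hMint k]
    have hlevel : ∀ k ∈ Finset.range m, ∫ ω, M k ω ∂μ
        ≤ K * (((d : ℝ) + 1) ^ 2 * R) / √n * (((k : ℝ) + 4) / 2 ^ k) := by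
      intro k _
      have hlog : Real.log (2 ^ ((k + 3) * d)) + 4 ≤ ((d : ℝ) + 1) * (k + 4) := by
        rw [Real.log_pow]
        push_cast
        have h1 : ((k : ℝ) + 3) * d * Real.log 2 ≤ (k + 3) * d * 1 := by
          gcongr
          linarith [Real.log_two_lt_d9]
        have : (0 : ℝ) ≤ k := k.cast_nonneg
        have : (0 : ℝ) ≤ d := d.cast_nonneg
        linarith
      refine (hMle k).trans ((mul_le_mul_of_nonneg_left hlog
        (div_nonneg (hb k).le (Real.sqrt_nonneg _))).trans (le_of_eq ?_))
      simp only [b]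
      ring
    have hsum := Finset.sum_le_sum hlevel
    rw [← Finset.mul_sum] at hsum
    have h10 := mul_le_mul_of_nonneg_left (sum_add_four_div_two_pow_le m)
      (show 0 ≤ K * (((d : ℝ) + 1) ^ 2 * R) / √n by positivity)
    have : K * (10 * ((d : ℝ) + 1) ^ 2 * R) / √n = K * (((d : ℝ) + 1) ^ 2 * R) / √n * 10 := by ring
    rw [this]
    simp only [integral_const, probReal_univ, smul_eq_mul, one_mul]
    linarith

end Deviation

/-! ### Parameter spaces -/

section ParameterSpace

lemma sqrt_sq_add_sq_le {a b : ℝ} (ha : 0 ≤ a) (hb : 0 ≤ b) : √(a ^ 2 + b ^ 2) ≤ a + b :=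
  Real.sqrt_le_iff.2 ⟨by positivity, by nlinarith [mul_nonneg ha hb]⟩

lemma norm_le_sum_abs {k : ℕ} (v : EuclideanSpace ℝ (Fin k)) : ‖v‖ ≤ ∑ i, |v i| := by
  rw [EuclideanSpace.norm_eq]
  refine Real.sqrt_le_iff.2 ⟨Finset.sum_nonneg fun i _ => abs_nonneg _, ?_⟩
  exact Finset.sum_sq_le_sq_sum_of_nonneg fun i _ => abs_nonneg _

/-- The coordinates of a pair of parameter vectors. -/
def pairCoord {k l : ℕ} (θ : EuclideanSpace ℝ (Fin k) × EuclideanSpace ℝ (Fin l)) :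
    Fin k ⊕ Fin l → ℝ :=
  Sum.elim θ.1 θ.2

lemma sqrt_le_sum_pairCoord {k l : ℕ}
    (θ θ' : EuclideanSpace ℝ (Fin k) × EuclideanSpace ℝ (Fin l)) :
    √(‖θ.1 - θ'.1‖ ^ 2 + ‖θ.2 - θ'.2‖ ^ 2) ≤ ∑ i, |pairCoord θ i - pairCoord θ' i| := by
  refine (sqrt_sq_add_sq_le (norm_nonneg _) (norm_nonneg _)).trans ?_
  rw [Fintype.sum_sum_type]
  exact add_le_add (norm_le_sum_abs _) (norm_le_sum_abs _)

variable {p q r : ℕ} {A : Set (EuclideanSpace ℝ (Fin p))} {B : Set (EuclideanSpace ℝ (Fin q))}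
  {Γ : Set (EuclideanSpace ℝ (Fin r))}

lemma isBounded_paramSpace (hA : Bornology.IsBounded A) (hB : Bornology.IsBounded B)
    (hΓ : Bornology.IsBounded Γ) : Bornology.IsBounded (paramSpace A B Γ) := by
  obtain ⟨a, ha⟩ := isBounded_iff_forall_norm_le.1 hA
  obtain ⟨b, hb⟩ := isBounded_iff_forall_norm_le.1 hB
  obtain ⟨c, hc⟩ := isBounded_iff_forall_norm_le.1 hΓ
  refine isBounded_iff_forall_norm_le.2 ⟨a + (b + c), fun θ hθ => ?_⟩
  have h1 := sqrt_sq_add_sq_le (norm_nonneg θ.fst) (norm_nonneg θ.snd)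
  have h2 := sqrt_sq_add_sq_le (norm_nonneg θ.snd.fst) (norm_nonneg θ.snd.snd)
  rw [← WithLp.prod_norm_eq_of_L2] at h1 h2
  linarith [ha _ hθ.1, hb _ hθ.2.1, hc _ hθ.2.2]

lemma norm_sub_le_diam_paramSpace (hb : Bornology.IsBounded (paramSpace A B Γ))
    {α α' : EuclideanSpace ℝ (Fin p)} {β β' : EuclideanSpace ℝ (Fin q)}
    {γ γ' : EuclideanSpace ℝ (Fin r)} (hα : α ∈ A) (hα' : α' ∈ A) (hβ : β ∈ B) (hβ' : β' ∈ B)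
    (hγ : γ ∈ Γ) (hγ' : γ' ∈ Γ) :
    ‖α - α'‖ ≤ Metric.diam (paramSpace A B Γ) ∧ ‖β - β'‖ ≤ Metric.diam (paramSpace A B Γ) ∧
      ‖γ - γ'‖ ≤ Metric.diam (paramSpace A B Γ) := by
  let θ : WithLp 2 (EuclideanSpace ℝ (Fin p) ×
      WithLp 2 (EuclideanSpace ℝ (Fin q) × EuclideanSpace ℝ (Fin r))) :=
    WithLp.toLp 2 (α, WithLp.toLp 2 (β, γ))
  let θ' : WithLp 2 (EuclideanSpace ℝ (Fin p) ×
      WithLp 2 (EuclideanSpace ℝ (Fin q) × EuclideanSpace ℝ (Fin r))) :=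
    WithLp.toLp 2 (α', WithLp.toLp 2 (β', γ'))
  have h : ‖θ - θ'‖ ≤ Metric.diam (paramSpace A B Γ) := by
    rw [← dist_eq_norm]
    exact Metric.dist_le_diam_of_mem hb ⟨hα, hβ, hγ⟩ ⟨hα', hβ', hγ'⟩
  have h1 : ‖(θ - θ').snd‖ ≤ ‖θ - θ'‖ := WithLp.norm_snd_le _ _
  exact ⟨(WithLp.norm_fst_le _ (θ - θ')).trans h,
    (WithLp.norm_fst_le _ (θ - θ').snd).trans (h1.trans h),
    (WithLp.norm_snd_le _ (θ - θ').snd).trans (h1.trans h)⟩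

lemma abs_pairCoord_sub_le {k l : ℕ} {R : ℝ}
    {θ θ' : EuclideanSpace ℝ (Fin k) × EuclideanSpace ℝ (Fin l)} (h1 : ‖θ.1 - θ'.1‖ ≤ R)
    (h2 : ‖θ.2 - θ'.2‖ ≤ R) (i : Fin k ⊕ Fin l) : |pairCoord θ i - pairCoord θ' i| ≤ R := by
  rcases i with i | i
  · exact (PiLp.norm_apply_le (θ.1 - θ'.1) i).trans h1
  · exact (PiLp.norm_apply_le (θ.2 - θ'.2) i).trans h2

end ParameterSpace

/-! ### Adversarial learning for one pair of domains -/

section Domain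

variable {X Z : Type*} [MeasurableSpace X] [MeasurableSpace Z] {p q r : ℕ}

/-- The regularity and capacity hypotheses for one pair of input laws `P`, `Q`: the log-terms of
the adversarial objective are finite and `K`-Lipschitz in the parameters, and the class of
discriminators contains the optimal one for each pair of representation laws. -/
structure IsAdversarialPair (A : Set (EuclideanSpace ℝ (Fin p)))
    (B : Set (EuclideanSpace ℝ (Fin q)))
    (Γ : Set (EuclideanSpace ℝ (Fin r))) (F : EuclideanSpace ℝ (Fin p) → X → Z)
    (G : EuclideanSpace ℝ (Fin q) → X → Z) (D : EuclideanSpace ℝ (Fin r) → Z → ℝ) (K : ℝ)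
    (P Q : Measure X) : Prop where
  measurable_left : ∀ α ∈ A, Measurable (F α)
  measurable_right : ∀ β ∈ B, Measurable (G β)
  measurable_disc : ∀ γ ∈ Γ, Measurable (D γ)
  disc_mem : ∀ γ ∈ Γ, ∀ z, D γ z ∈ Set.Icc (0 : ℝ) 1
  disc_pos : ∀ α ∈ A, ∀ γ ∈ Γ, ∀ x, 0 < D γ (F α x)
  disc_lt_one : ∀ β ∈ B, ∀ γ ∈ Γ, ∀ x, D γ (G β x) < 1
  nonneg : 0 ≤ K
  lipschitz_left : ∀ α ∈ A, ∀ α' ∈ A, ∀ γ ∈ Γ, ∀ γ' ∈ Γ, ∀ x,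
    |Real.log (D γ (F α x)) - Real.log (D γ' (F α' x))| ≤ K * √(‖α - α'‖ ^ 2 + ‖γ - γ'‖ ^ 2)
  lipschitz_right : ∀ β ∈ B, ∀ β' ∈ B, ∀ γ ∈ Γ, ∀ γ' ∈ Γ, ∀ x,
    |Real.log (1 - D γ (G β x)) - Real.log (1 - D γ' (G β' x))|
      ≤ K * √(‖β - β'‖ ^ 2 + ‖γ - γ'‖ ^ 2)
  capacity : ∀ α ∈ A, ∀ β ∈ B, ∃ γ ∈ Γ, ∀ᵐ z ∂(P.map (F α) + Q.map (G β)),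
    D γ z = ((P.map (F α)).rnDeriv (P.map (F α) + Q.map (G β)) z).toReal

namespace IsAdversarialPair

variable {A : Set (EuclideanSpace ℝ (Fin p))} {B : Set (EuclideanSpace ℝ (Fin q))}
  {Γ : Set (EuclideanSpace ℝ (Fin r))} {F : EuclideanSpace ℝ (Fin p) → X → Z}
  {G : EuclideanSpace ℝ (Fin q) → X → Z} {D : EuclideanSpace ℝ (Fin r) → Z → ℝ} {K : ℝ}
  {P Q : Measure X} {α α' : EuclideanSpace ℝ (Fin p)} {β β' : EuclideanSpace ℝ (Fin q)}
  {γ : EuclideanSpace ℝ (Fin r)}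

lemma integral_log_left (h : IsAdversarialPair A B Γ F G D K P Q) (hα : α ∈ A) (hγ : γ ∈ Γ) :
    ∫ z, Real.log (D γ z) ∂(P.map (F α)) = ∫ x, Real.log (D γ (F α x)) ∂P :=
  integral_map (h.measurable_left α hα).aemeasurable
    (h.measurable_disc γ hγ).log.aestronglyMeasurable

lemma integral_log_right (h : IsAdversarialPair A B Γ F G D K P Q) (hβ : β ∈ B) (hγ : γ ∈ Γ) :
    ∫ z, Real.log (1 - D γ z) ∂(Q.map (G β)) = ∫ x, Real.log (1 - D γ (G β x)) ∂Q :=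
  integral_map (h.measurable_right β hβ).aemeasurable
    ((h.measurable_disc γ hγ).const_sub 1).log.aestronglyMeasurable

lemma measurable_log_left (h : IsAdversarialPair A B Γ F G D K P Q) (hα : α ∈ A) (hγ : γ ∈ Γ) :
    Measurable fun x => Real.log (D γ (F α x)) :=
  ((h.measurable_disc γ hγ).comp (h.measurable_left α hα)).log

lemma measurable_log_right (h : IsAdversarialPair A B Γ F G D K P Q) (hβ : β ∈ B) (hγ : γ ∈ Γ) :
    Measurable fun x => Real.log (1 - D γ (G β x)) :=
  (((h.measurable_disc γ hγ).comp (h.measurable_right β hβ)).const_sub 1).log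

lemma isProbabilityMeasure_left [IsProbabilityMeasure P]
    (h : IsAdversarialPair A B Γ F G D K P Q) (hα : α ∈ A) :
    IsProbabilityMeasure (P.map (F α)) :=
  Measure.isProbabilityMeasure_map (h.measurable_left α hα).aemeasurable

lemma isProbabilityMeasure_right [IsProbabilityMeasure Q]
    (h : IsAdversarialPair A B Γ F G D K P Q) (hβ : β ∈ B) :
    IsProbabilityMeasure (Q.map (G β)) :=
  Measure.isProbabilityMeasure_map (h.measurable_right β hβ).aemeasurable

lemma empObjective_eq (h : IsAdversarialPair A B Γ F G D K P Q) (hα : α ∈ A) (hβ : β ∈ B)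
    (hγ : γ ∈ Γ) {n : ℕ} (x x' : Fin n → X) :
    empObjective F G D x x' α β γ = popObjective F G D P Q α β γ
      + empDev P x (fun y => Real.log (D γ (F α y)))
      + empDev Q x' (fun y => Real.log (1 - D γ (G β y))) := by
  rw [popObjective, h.integral_log_left hα hγ, h.integral_log_right hβ hγ, empObjective, empDev,
    empDev]
  ring

variable [IsProbabilityMeasure P] [IsProbabilityMeasure Q]

/-- The log-terms are integrable: at the optimal discriminator because `t log t` is bounded on
`[0, 1]`, elsewhere because they stay at a bounded distance from it. -/
lemma integrable_log_left (h : IsAdversarialPair A B Γ F G D K P Q) (hα : α ∈ A) (hβ : β ∈ B)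
    (hγ : γ ∈ Γ) : Integrable (fun x => Real.log (D γ (F α x))) P := by
  have := h.isProbabilityMeasure_left hα
  have := h.isProbabilityMeasure_right hβ
  obtain ⟨γ', hγ', hopt⟩ := h.capacity α hα β hβ
  have h1 : Integrable (fun z => Real.log (D γ' z)) (P.map (F α)) := by
    refine (integrable_log_rnDeriv_add (P.map (F α)) (Q.map (G β))).congr ?_
    filter_upwards [ae_mono (Measure.le_add_right le_rfl) hopt] with z hz
    rw [hz]
  have h2 := h1.comp_measurable (h.measurable_left α hα)
  have h3 : Integrable (fun x => Real.log (D γ (F α x)) - Real.log (D γ' (F α x))) P :=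
    Integrable.of_bound
      ((h.measurable_log_left hα hγ).sub (h.measurable_log_left hα hγ')).aestronglyMeasurable _
      (ae_of_all _ (h.lipschitz_left α hα α hα γ hγ γ' hγ'))
  refine (h3.add h2).congr (ae_of_all _ fun x => ?_)
  simp

lemma integrable_log_right (h : IsAdversarialPair A B Γ F G D K P Q) (hα : α ∈ A) (hβ : β ∈ B)
    (hγ : γ ∈ Γ) : Integrable (fun x => Real.log (1 - D γ (G β x))) Q := by
  have := h.isProbabilityMeasure_left hα
  have := h.isProbabilityMeasure_right hβ
  obtain ⟨γ', hγ', hopt⟩ := h.capacity α hα β hβ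
  have h1 : Integrable (fun z => Real.log (1 - D γ' z)) (Q.map (G β)) := by
    refine (integrable_log_one_sub_rnDeriv_add (P.map (F α)) (Q.map (G β))).congr ?_
    filter_upwards [ae_mono (Measure.le_add_left le_rfl) hopt] with z hz
    rw [hz]
  have h2 := h1.comp_measurable (h.measurable_right β hβ)
  have h3 : Integrable (fun x => Real.log (1 - D γ (G β x)) - Real.log (1 - D γ' (G β x))) Q :=
    Integrable.of_bound
      ((h.measurable_log_right hβ hγ).sub (h.measurable_log_right hβ hγ')).aestronglyMeasurable _
      (ae_of_all _ (h.lipschitz_right β hβ β hβ γ hγ γ' hγ'))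
  refine (h3.add h2).congr (ae_of_all _ fun x => ?_)
  simp

lemma popObjective_le (h : IsAdversarialPair A B Γ F G D K P Q) (hα : α ∈ A) (hβ : β ∈ B)
    (hγ : γ ∈ Γ) :
    popObjective F G D P Q α β γ ≤ 2 * (jsDiv (P.map (F α)) (Q.map (G β)) - Real.log 2) := by
  have := h.isProbabilityMeasure_left hα
  have := h.isProbabilityMeasure_right hβ
  have hF := h.measurable_left α hα
  have hG := h.measurable_right β hβ
  have hD := h.measurable_disc γ hγ
  refine integral_log_discriminator_le_jsDiv _ _ (h.disc_mem γ hγ) ?_ ?_ ?_ ?_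
  · exact (ae_map_iff hF.aemeasurable (measurableSet_lt measurable_const hD)).2
      (ae_of_all _ (h.disc_pos α hα γ hγ))
  · exact (ae_map_iff hG.aemeasurable (measurableSet_lt hD measurable_const)).2
      (ae_of_all _ (h.disc_lt_one β hβ γ hγ))
  · exact (integrable_map_measure hD.log.aestronglyMeasurable hF.aemeasurable).2
      (h.integrable_log_left hα hβ hγ)
  · exact (integrable_map_measure (hD.const_sub 1).log.aestronglyMeasurable hG.aemeasurable).2
      (h.integrable_log_right hα hβ hγ)

lemma exists_popObjective_eq (h : IsAdversarialPair A B Γ F G D K P Q) (hα : α ∈ A)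
    (hβ : β ∈ B) : ∃ γ ∈ Γ, popObjective F G D P Q α β γ
      = 2 * (jsDiv (P.map (F α)) (Q.map (G β)) - Real.log 2) := by
  have := h.isProbabilityMeasure_left hα
  have := h.isProbabilityMeasure_right hβ
  obtain ⟨γ, hγ, hopt⟩ := h.capacity α hα β hβ
  refine ⟨γ, hγ, ?_⟩
  rw [jsDiv_eq, popObjective]
  have h1 : ∀ᵐ z ∂(P.map (F α)), D γ z
      = ((P.map (F α)).rnDeriv (P.map (F α) + Q.map (G β)) z).toReal :=
    ae_mono (Measure.le_add_right le_rfl) hopt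
  have h2 : ∀ᵐ z ∂(Q.map (G β)), D γ z
      = ((P.map (F α)).rnDeriv (P.map (F α) + Q.map (G β)) z).toReal :=
    ae_mono (Measure.le_add_left le_rfl) hopt
  rw [integral_congr_ae (h1.mono fun z hz => congrArg Real.log hz),
    integral_congr_ae (h2.mono fun z hz => congrArg (fun t => Real.log (1 - t)) hz)]
  ring

lemma jsDiv_le_log_two (h : IsAdversarialPair A B Γ F G D K P Q) (hα : α ∈ A) (hβ : β ∈ B) :
    jsDiv (P.map (F α)) (Q.map (G β)) ≤ Real.log 2 := by
  obtain ⟨γ, hγ, heq⟩ := h.exists_popObjective_eq hα hβ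
  have h1 : ∫ z, Real.log (D γ z) ∂(P.map (F α)) ≤ 0 := integral_nonpos fun z =>
    Real.log_nonpos (h.disc_mem γ hγ z).1 (h.disc_mem γ hγ z).2
  have h2 : ∫ z, Real.log (1 - D γ z) ∂(Q.map (G β)) ≤ 0 := integral_nonpos fun z =>
    Real.log_nonpos (sub_nonneg.2 (h.disc_mem γ hγ z).2) (by linarith [(h.disc_mem γ hγ z).1])
  rw [popObjective] at heq
  linarith

/-- Evaluating both objectives at the discriminator which is optimal for `(α, β)`. -/
lemma jsDiv_sub_le (h : IsAdversarialPair A B Γ F G D K P Q) (hα : α ∈ A) (hβ : β ∈ B)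
    (hα' : α' ∈ A) (hβ' : β' ∈ B) :
    jsDiv (P.map (F α)) (Q.map (G β)) - jsDiv (P.map (F α')) (Q.map (G β'))
      ≤ K * ‖(α, β) - (α', β')‖ := by
  obtain ⟨γ, hγ, heq⟩ := h.exists_popObjective_eq hα hβ
  have hle := h.popObjective_le hα' hβ' hγ
  rw [popObjective, h.integral_log_left hα hγ, h.integral_log_right hβ hγ] at heq
  rw [popObjective, h.integral_log_left hα' hγ, h.integral_log_right hβ' hγ] at hle
  have h1 : (∫ x, Real.log (D γ (F α x)) ∂P) - ∫ x, Real.log (D γ (F α' x)) ∂P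
      ≤ K * ‖α - α'‖ := by
    rw [← integral_sub (h.integrable_log_left hα hβ hγ) (h.integrable_log_left hα' hβ hγ)]
    have := norm_integral_le_of_norm_le_const (μ := P)
      (f := fun x => Real.log (D γ (F α x)) - Real.log (D γ (F α' x)))
      (ae_of_all _ (h.lipschitz_left α hα α' hα' γ hγ γ hγ))
    simpa using (le_abs_self _).trans this
  have h2 : (∫ x, Real.log (1 - D γ (G β x)) ∂Q) - ∫ x, Real.log (1 - D γ (G β' x)) ∂Q
      ≤ K * ‖β - β'‖ := by
    rw [← integral_sub (h.integrable_log_right hα hβ hγ) (h.integrable_log_right hα hβ' hγ)]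
    have := norm_integral_le_of_norm_le_const (μ := Q)
      (f := fun x => Real.log (1 - D γ (G β x)) - Real.log (1 - D γ (G β' x)))
      (ae_of_all _ (h.lipschitz_right β hβ β' hβ' γ hγ γ hγ))
    simpa using (le_abs_self _).trans this
  have h3 := mul_le_mul_of_nonneg_left (norm_fst_le ((α, β) - (α', β'))) h.nonneg
  have h4 := mul_le_mul_of_nonneg_left (norm_snd_le ((α, β) - (α', β'))) h.nonneg
  simp only [Prod.mk_sub_mk] at h3 h4 ⊢
  linarith

/-- `A` and `B` need not be measurable; the divergence is Lipschitz on `A × B`, hence agrees there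
with a continuous function on the whole space. -/
lemma integrable_jsDiv_comp (h : IsAdversarialPair A B Γ F G D K P Q) {Ω : Type*}
    [MeasurableSpace Ω] {μ : Measure Ω} [IsFiniteMeasure μ]
    {αh : Ω → EuclideanSpace ℝ (Fin p)} {βh : Ω → EuclideanSpace ℝ (Fin q)}
    (hαm : Measurable αh) (hβm : Measurable βh) (hmem : ∀ᵐ ω ∂μ, αh ω ∈ A ∧ βh ω ∈ B) :
    Integrable (fun ω => jsDiv (P.map (F (αh ω))) (Q.map (G (βh ω)))) μ := by
  have hlip : LipschitzOnWith K.toNNReal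
      (fun θ : EuclideanSpace ℝ (Fin p) × EuclideanSpace ℝ (Fin q) =>
        jsDiv (P.map (F θ.1)) (Q.map (G θ.2))) (A ×ˢ B) := by
    refine LipschitzOnWith.of_dist_le_mul fun θ hθ θ' hθ' => ?_
    rw [Real.coe_toNNReal _ h.nonneg, Real.dist_eq, dist_eq_norm]
    refine abs_sub_le_iff.2 ⟨h.jsDiv_sub_le hθ.1 hθ.2 hθ'.1 hθ'.2, ?_⟩
    rw [norm_sub_rev]
    exact h.jsDiv_sub_le hθ'.1 hθ'.2 hθ.1 hθ.2
  obtain ⟨J, hJ, hJeq⟩ := hlip.extend_real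
  refine Integrable.of_bound (C := Real.log 2)
    ⟨fun ω => J (αh ω, βh ω), ?_, ?_⟩ ?_
  · exact (hJ.continuous.measurable.comp (hαm.prodMk hβm)).stronglyMeasurable
  · filter_upwards [hmem] with ω hω using hJeq (Set.mk_mem_prod hω.1 hω.2)
  · filter_upwards [hmem] with ω hω
    rw [Real.norm_eq_abs, abs_of_nonneg (jsDiv_nonneg _ _)]
    exact h.jsDiv_le_log_two hω.1 hω.2

/-- The excess risk of an empirical minimax pair is at most the sum of the oscillation bounds of the
two centred empirical processes: the empirical objective is evaluated at the discriminator which is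
optimal for the learned pair, and only differences of deviations remain. -/
lemma jsDiv_le_of_isMinimax (h : IsAdversarialPair A B Γ F G D K P Q) {n : ℕ} {x x' : Fin n → X}
    (hmin : IsMinimax (empObjective F G D x x') A B Γ α β) (hα' : α' ∈ A) (hβ' : β' ∈ B)
    {a₁ a₂ M₁ M₂ : ℝ}
    (h₁ : ∀ α ∈ A, ∀ γ ∈ Γ, |empDev P x (fun y => Real.log (D γ (F α y))) - a₁| ≤ M₁)
    (h₂ : ∀ β ∈ B, ∀ γ ∈ Γ, |empDev Q x' (fun y => Real.log (1 - D γ (G β y))) - a₂| ≤ M₂) :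
    jsDiv (P.map (F α)) (Q.map (G β)) ≤ jsDiv (P.map (F α')) (Q.map (G β')) + (M₁ + M₂) := by
  obtain ⟨hα, hβ, hmin⟩ := hmin
  obtain ⟨γ, hγ, heq⟩ := h.exists_popObjective_eq hα hβ
  have hbdd : BddAbove (Set.range fun γ : Γ => empObjective F G D x x' α β γ) := by
    refine ⟨0, ?_⟩
    rintro _ ⟨γ, rfl⟩
    refine add_nonpos ?_ ?_
    · exact mul_nonpos_of_nonneg_of_nonpos (by positivity) (Finset.sum_nonpos fun i _ =>
        Real.log_nonpos (h.disc_mem γ γ.2 _).1 (h.disc_mem γ γ.2 _).2)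
    · exact mul_nonpos_of_nonneg_of_nonpos (by positivity) (Finset.sum_nonpos fun i _ =>
        Real.log_nonpos (sub_nonneg.2 (h.disc_mem γ γ.2 _).2)
          (by linarith [(h.disc_mem γ γ.2 (G β (x' i))).1]))
  have hlow := le_ciSup hbdd ⟨γ, hγ⟩
  have : Nonempty Γ := ⟨⟨γ, hγ⟩⟩
  have hup : (⨆ γ : Γ, empObjective F G D x x' α' β' γ)
      ≤ 2 * (jsDiv (P.map (F α')) (Q.map (G β')) - Real.log 2) + (a₁ + M₁) + (a₂ + M₂) := by
    refine ciSup_le fun γ => ?_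
    rw [h.empObjective_eq hα' hβ' γ.2]
    linarith [h.popObjective_le hα' hβ' γ.2, (abs_le.1 (h₁ α' hα' γ γ.2)).2,
      (abs_le.1 (h₂ β' hβ' γ γ.2)).2]
  have hall := hlow.trans ((hmin α' hα' β' hβ').trans hup)
  simp only [h.empObjective_eq hα hβ hγ, heq] at hall
  linarith [(abs_le.1 (h₁ α hα γ hγ)).1, (abs_le.1 (h₂ β hβ γ hγ)).1]

end IsAdversarialPair

end Domain

/-! ### Expected excess divergence -/

section Risk

variable {X Z Ω : Type*} [MeasurableSpace X] [MeasurableSpace Z] [MeasurableSpace Ω] {p q r : ℕ}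
  {A : Set (EuclideanSpace ℝ (Fin p))} {B : Set (EuclideanSpace ℝ (Fin q))}
  {Γ : Set (EuclideanSpace ℝ (Fin r))} {F : EuclideanSpace ℝ (Fin p) → X → Z}
  {G : EuclideanSpace ℝ (Fin q) → X → Z} {D : EuclideanSpace ℝ (Fin r) → Z → ℝ} {K : ℝ}
  {P Q : Measure X}

/-- The expected excess divergence of an empirical minimax pair, for one pair of domains. The
diameter is increased by one so that the grid has positive mesh also for a single parameter. -/
theorem IsAdversarialPair.integral_jsDiv_le (h : IsAdversarialPair A B Γ F G D K P Q)
    (hA : Bornology.IsBounded A) (hB : Bornology.IsBounded B) (hΓ : Bornology.IsBounded Γ)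
    {μ : Measure Ω} [IsProbabilityMeasure μ] {n : ℕ} (hn : 0 < n) {x x' : Fin n → Ω → X}
    (hx : ∀ i, Measurable (x i)) (hx' : ∀ i, Measurable (x' i)) (hind : iIndepFun x μ)
    (hind' : iIndepFun x' μ) (hlaw : ∀ i, μ.map (x i) = P) (hlaw' : ∀ i, μ.map (x' i) = Q)
    {αh : Ω → EuclideanSpace ℝ (Fin p)} {βh : Ω → EuclideanSpace ℝ (Fin q)}
    (hαm : Measurable αh) (hβm : Measurable βh)
    (hmin : ∀ᵐ ω ∂μ, IsMinimax (empObjective F G D (fun i => x i ω) (fun i => x' i ω)) A B Γ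
      (αh ω) (βh ω))
    {α : EuclideanSpace ℝ (Fin p)} {β : EuclideanSpace ℝ (Fin q)} (hα : α ∈ A) (hβ : β ∈ B) :
    Integrable (fun ω => jsDiv (P.map (F (αh ω))) (Q.map (G (βh ω)))) μ ∧
      ∫ ω, jsDiv (P.map (F (αh ω))) (Q.map (G (βh ω))) ∂μ
        ≤ jsDiv (P.map (F α)) (Q.map (G β))
          + K * (20 * (((p + q + r : ℕ) : ℝ) + 1) ^ 2 * (Metric.diam (paramSpace A B Γ) + 1))
            / √(n : ℝ) := by
  have hP : IsProbabilityMeasure P := by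
    rw [← hlaw ⟨0, hn⟩]; exact Measure.isProbabilityMeasure_map (hx _).aemeasurable
  have hQ : IsProbabilityMeasure Q := by
    rw [← hlaw' ⟨0, hn⟩]; exact Measure.isProbabilityMeasure_map (hx' _).aemeasurable
  have hint := h.integrable_jsDiv_comp hαm hβm (hmin.mono fun ω hω => ⟨hω.1, hω.2.1⟩)
  refine ⟨hint, ?_⟩
  obtain ⟨γ, hγ, -⟩ := h.capacity α hα β hβ
  have hbdd := isBounded_paramSpace hA hB hΓ
  set R : ℝ := Metric.diam (paramSpace A B Γ) + 1 with hR
  have hR0 : 0 < R := by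
    have : 0 ≤ Metric.diam (paramSpace A B Γ) := Metric.diam_nonneg
    linarith
  have hK := h.nonneg
  -- the number of parameters of either process is at most `p + q + r`
  have hcard : ∀ {k : ℕ}, k ≤ p + q + r → K * (10 * ((k : ℝ) + 1) ^ 2 * R) / √(n : ℝ)
      ≤ K * (10 * (((p + q + r : ℕ) : ℝ) + 1) ^ 2 * R) / √(n : ℝ) := by
    intro k hk
    have : (k : ℝ) ≤ ((p + q + r : ℕ) : ℝ) := by exact_mod_cast hk
    gcongr
  refine le_of_forall_pos_le_add fun η hη => ?_
  obtain ⟨M₁, hM₁i, hM₁, hM₁le⟩ := exists_uniform_empDev_bound hn hx hind hlaw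
    (pairCoord (k := p) (l := r)) (S := A ×ˢ Γ) hR0
    (fun θ hθ θ' hθ' => by
      obtain ⟨h1, -, h2⟩ := norm_sub_le_diam_paramSpace hbdd hθ.1 hθ'.1 hβ hβ hθ.2 hθ'.2
      exact abs_pairCoord_sub_le (by linarith) (by linarith))
    (f := fun θ y => Real.log (D θ.2 (F θ.1 y)))
    (fun θ hθ => h.measurable_log_left hθ.1 hθ.2)
    (fun θ hθ => h.integrable_log_left hθ.1 hβ hθ.2) hK
    (fun θ hθ θ' hθ' y => (h.lipschitz_left _ hθ.1 _ hθ'.1 _ hθ.2 _ hθ'.2 y).trans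
      (mul_le_mul_of_nonneg_left (sqrt_le_sum_pairCoord θ θ') hK))
    (θ₀ := (α, γ)) ⟨hα, hγ⟩ (half_pos hη)
  obtain ⟨M₂, hM₂i, hM₂, hM₂le⟩ := exists_uniform_empDev_bound hn hx' hind' hlaw'
    (pairCoord (k := q) (l := r)) (S := B ×ˢ Γ) hR0
    (fun θ hθ θ' hθ' => by
      obtain ⟨-, h1, h2⟩ := norm_sub_le_diam_paramSpace hbdd hα hα hθ.1 hθ'.1 hθ.2 hθ'.2
      exact abs_pairCoord_sub_le (by linarith) (by linarith))
    (f := fun θ y => Real.log (1 - D θ.2 (G θ.1 y)))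
    (fun θ hθ => h.measurable_log_right hθ.1 hθ.2)
    (fun θ hθ => h.integrable_log_right hα hθ.1 hθ.2) hK
    (fun θ hθ θ' hθ' y => (h.lipschitz_right _ hθ.1 _ hθ'.1 _ hθ.2 _ hθ'.2 y).trans
      (mul_le_mul_of_nonneg_left (sqrt_le_sum_pairCoord θ θ') hK))
    (θ₀ := (β, γ)) ⟨hβ, hγ⟩ (half_pos hη)
  rw [Fintype.card_sum, Fintype.card_fin, Fintype.card_fin] at hM₁le hM₂le
  have hc₁ := hcard (k := p + r) (by omega)
  have hc₂ := hcard (k := q + r) (by omega)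
  have hMi : Integrable (fun ω => M₁ ω + M₂ ω) μ := hM₁i.add hM₂i
  have hmono := integral_mono_ae hint ((integrable_const _).add hMi)
    (hmin.mono fun ω hω => h.jsDiv_le_of_isMinimax hω hα hβ
      (fun α' hα' γ' hγ' => hM₁ ω (α', γ') ⟨hα', hγ'⟩)
      (fun β' hβ' γ' hγ' => hM₂ ω (β', γ') ⟨hβ', hγ'⟩))
  have hsplit : ∫ ω, (jsDiv (P.map (F α)) (Q.map (G β)) + (M₁ ω + M₂ ω)) ∂μ
      = jsDiv (P.map (F α)) (Q.map (G β)) + (∫ ω, M₁ ω ∂μ + ∫ ω, M₂ ω ∂μ) := by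
    rw [integral_add (integrable_const _) hMi, integral_add hM₁i hM₂i]
    simp
  have hdouble : K * (20 * (((p + q + r : ℕ) : ℝ) + 1) ^ 2 * R) / √(n : ℝ)
      = 2 * (K * (10 * (((p + q + r : ℕ) : ℝ) + 1) ^ 2 * R) / √(n : ℝ)) := by ring
  refine (hmono.trans_eq hsplit).trans ?_
  rw [hdouble]
  linarith

end Risk

end AdvRep

theorem mainTheorem3 :
    ∃ C : ℝ → ℕ → ℝ,
      ∀ (X Y Z Ω : Type*) [MeasurableSpace X] [MeasurableSpace Y] [Finite Y]
        [MeasurableSingletonClass Y] [MeasurableSpace Z] [MeasurableSpace Ω]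
        (μ : Measure Ω) [IsProbabilityMeasure μ]
        -- the domains
        (T : ℕ) (_ : 0 < T) (P : Fin (T + 1) → Measure (X × Y)) (_ : ∀ t, IsProbabilityMeasure (P t))
        -- the importance weights of consecutive domains are well defined
        (_ : ∀ (t : Fin T) (y : Y),
          AdvRep.labelProb (P t.castSucc) y = 0 → AdvRep.labelProb (P t.succ) y = 0)
        -- bounded parameter spaces in Euclidean spaces
        (p q r : ℕ) (A : Set (EuclideanSpace ℝ (Fin p))) (B : Set (EuclideanSpace ℝ (Fin q)))
        (Γ : Set (EuclideanSpace ℝ (Fin r)))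
        (_ : Bornology.IsBounded A) (_ : Bornology.IsBounded B) (_ : Bornology.IsBounded Γ)
        -- the representation networks and the discriminators
        (F : EuclideanSpace ℝ (Fin p) → X → Z) (G : EuclideanSpace ℝ (Fin q) → X → Z)
        (D : EuclideanSpace ℝ (Fin r) → Z → ℝ)
        (_ : ∀ α ∈ A, Measurable (F α)) (_ : ∀ β ∈ B, Measurable (G β))
        (_ : ∀ γ ∈ Γ, Measurable (D γ)) (_ : ∀ γ ∈ Γ, ∀ z, D γ z ∈ Set.Icc (0 : ℝ) 1)
        -- the logarithms in the objective are finite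
        (_ : ∀ α ∈ A, ∀ γ ∈ Γ, ∀ x, 0 < D γ (F α x)) (_ : ∀ β ∈ B, ∀ γ ∈ Γ, ∀ x, D γ (G β x) < 1)
        -- they are Lipschitz in the parameters
        (K : ℝ) (_ : 0 ≤ K)
        (_ : ∀ α ∈ A, ∀ α' ∈ A, ∀ γ ∈ Γ, ∀ γ' ∈ Γ, ∀ x,
          |Real.log (D γ (F α x)) - Real.log (D γ' (F α' x))|
            ≤ K * √(‖α - α'‖ ^ 2 + ‖γ - γ'‖ ^ 2))
        (_ : ∀ β ∈ B, ∀ β' ∈ B, ∀ γ ∈ Γ, ∀ γ' ∈ Γ, ∀ x,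
          |Real.log (1 - D γ (G β x)) - Real.log (1 - D γ' (G β' x))|
            ≤ K * √(‖β - β'‖ ^ 2 + ‖γ - γ'‖ ^ 2))
        -- the discriminator class contains, for each pair of representation laws, the density of
        -- the first law with respect to the sum of both
        (_ : ∀ t : Fin T, ∀ α ∈ A, ∀ β ∈ B, ∃ γ ∈ Γ,
          ∀ᵐ z ∂((AdvRep.sourceLaw P t).map (F α) + (AdvRep.nextLaw P t).map (G β)),
            D γ z = (((AdvRep.sourceLaw P t).map (F α)).rnDeriv
              ((AdvRep.sourceLaw P t).map (F α) + (AdvRep.nextLaw P t).map (G β)) z).toReal)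
        -- i.i.d. datasets of size `n`
        (n : ℕ) (_ : 0 < n) (x x' : Fin T → Fin n → Ω → X)
        (_ : ∀ t i, Measurable (x t i)) (_ : ∀ t i, Measurable (x' t i))
        (_ : ∀ t, iIndepFun (x t) μ) (_ : ∀ t, iIndepFun (x' t) μ)
        (_ : ∀ t i, μ.map (x t i) = AdvRep.sourceLaw P t)
        (_ : ∀ t i, μ.map (x' t i) = AdvRep.nextLaw P t)
        -- the parameters learned from the datasets
        (αhat : Fin T → Ω → EuclideanSpace ℝ (Fin p)) (βhat : Fin T → Ω → EuclideanSpace ℝ (Fin q))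
        (_ : ∀ t, Measurable (αhat t)) (_ : ∀ t, Measurable (βhat t))
        (_ : ∀ t, ∀ᵐ ω ∂μ, AdvRep.IsMinimax
          (AdvRep.empObjective F G D (fun i => x t i ω) (fun i => x' t i ω)) A B Γ
          (αhat t ω) (βhat t ω))
        -- the parameters learned from infinite data
        (αstar : Fin T → EuclideanSpace ℝ (Fin p)) (βstar : Fin T → EuclideanSpace ℝ (Fin q))
        (_ : ∀ t, AdvRep.IsMinimax
          (AdvRep.popObjective F G D (AdvRep.sourceLaw P t) (AdvRep.nextLaw P t)) A B Γ
          (αstar t) (βstar t)),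
        Integrable (fun ω => AdvRep.dSrc P F G (fun t => αhat t ω) (fun t => βhat t ω)) μ ∧
        ∫ ω, AdvRep.dSrc P F G (fun t => αhat t ω) (fun t => βhat t ω) ∂μ
          ≤ AdvRep.dSrc P F G αstar βstar
            + K * C (Metric.diam (AdvRep.paramSpace A B Γ)) (p + q + r) / √(n : ℝ) := by
  refine ⟨fun R d => 20 * ((d : ℝ) + 1) ^ 2 * (R + 1), ?_⟩
  intro X Y Z Ω _ _ _ _ _ _ μ _ T hT P _ _ p q r A B Γ hA hB hΓ F G D hF hG hD hD01 hpos hlt K hK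
    hLF hLG hcap n hn x x' hx hx' hind hind' hlaw hlaw' αhat βhat hα hβ hmin αstar βstar hstar
  have hstep := fun t : Fin T =>
    (AdvRep.IsAdversarialPair.mk hF hG hD hD01 hpos hlt hK hLF hLG (hcap t)).integral_jsDiv_le
      hA hB hΓ hn (hx t) (hx' t) (hind t) (hind' t) (hlaw t) (hlaw' t) (hα t) (hβ t) (hmin t)
      (hstar t).1 (hstar t).2.1
  refine ⟨(integrable_finsetSum _ fun t _ => (hstep t).1).const_mul _, ?_⟩
  simp only [AdvRep.dSrc]
  rw [integral_const_mul, integral_finsetSum _ fun t _ => (hstep t).1]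
  have hsum := Finset.sum_le_sum fun t (_ : t ∈ Finset.univ) => (hstep t).2
  rw [Finset.sum_add_distrib, Finset.sum_const, Finset.card_univ, Fintype.card_fin,
    nsmul_eq_mul] at hsum
  have hT' : (0 : ℝ) < T := by exact_mod_cast hT
  refine (mul_le_mul_of_nonneg_left hsum (by positivity)).trans_eq ?_
  rw [mul_add, ← mul_assoc (1 / (T : ℝ)) (T : ℝ), one_div_mul_cancel hT'.ne', one_mul]
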